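/- A (simple) $t$-$(v,k,\lambda)$ design $\mathcal{D}$ is a set $X$ of $v$ points together with a set of $k$-element subsets of $X$, called blocks, such that every $t$-element subset of $X$ is contained in exactly $\lambda$ blocks. It is called self-orthogonal if $|B\cap B'|\equiv k \pmod 2$ for any two distinct blocks $B, B'$. Let $C(\mathcal{D})\subseteq \mathbb{F}_2^{X}$ be the binary code generated by the rows of the block-point incidence matrix of $\mathcal{D}$, and for a code $C\subseteq\mathbb{F}_2^X$ let $C^\perp$ be its dual with respect to the standard inner product. **Proposition 3.2.** Let $\mathcal{D}$ be a self-orthogonal $5$-$(v,k,\lambda)$ design, where $(v,k,\lambda)$ is one of $$(120,36,37237713920),\quad (120,40,1372275835848),\quad (120,44,26386953577600),$$ $$(120,48,274320081834480),\quad (144,56,283096123959568608).$$ Then $C(\mathcal{D})$ is self-dual, that is, $C(\mathcal{D})=C(\mathcal{D})^\perp$. -/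

import Mathlib

namespace SelfDualDesign

/-- `IsDesign X t v k lam blocks`: the set `blocks` of subsets of the finite point set `X` is a
(simple) `t`-`(v, k, lam)` design. There are `v` points, each block has `k` points, and each
`t`-subset of points lies in exactly `lam` blocks. Blocks form a set, so none is repeated. -/
structure IsDesign (X : Type*) [Fintype X] [DecidableEq X] (t v k lam : ℕ)
    (blocks : Finset (Finset X)) : Prop where
  card_points : Fintype.card X = v
  card_block : ∀ b ∈ blocks, b.card = k
  card_through : ∀ T : Finset X, T.card = t → (blocks.filter fun b => T ⊆ b).card = lam

/-- A design with block size `k` is self-orthogonal if any two distinct blocks meet in a number of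
points that has the same parity as `k`. -/
def IsSelfOrthogonal {X : Type*} [DecidableEq X] (k : ℕ) (blocks : Finset (Finset X)) : Prop :=
  ∀ b₁ ∈ blocks, ∀ b₂ ∈ blocks, b₁ ≠ b₂ → (b₁ ∩ b₂).card ≡ k [MOD 2]

/-- The block-point incidence matrix, over the field with two elements. -/
def incidenceMatrix {X : Type*} [DecidableEq X] (blocks : Finset (Finset X)) :
    Matrix blocks X (ZMod 2) :=
  Matrix.of fun b x => if x ∈ b.1 then 1 else 0

/-- The binary code generated by the rows of the incidence matrix. -/
def code {X : Type*} [DecidableEq X] (blocks : Finset (Finset X)) :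
    Submodule (ZMod 2) (X → ZMod 2) :=
  Submodule.span (ZMod 2) (Set.range (incidenceMatrix blocks).row)

/-- The dual of a binary code under the standard inner product. -/
def dualCode {X : Type*} [Fintype X] (C : Submodule (ZMod 2) (X → ZMod 2)) :
    Submodule (ZMod 2) (X → ZMod 2) where
  carrier := {y | ∀ x ∈ C, x ⬝ᵥ y = 0}
  zero_mem' := fun x _ => dotProduct_zero x
  add_mem' := fun {y z} hy hz x hx => by rw [dotProduct_add, hy x hx, hz x hx, add_zero]
  smul_mem' := fun c y hy x hx => by rw [dotProduct_smul, hy x hx, smul_zero]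

/-- A binary code is self-dual if it equals its dual. -/
def IsSelfDual {X : Type*} [Fintype X] (C : Submodule (ZMod 2) (X → ZMod 2)) : Prop :=
  C = dualCode C

end SelfDualDesign

/-!
Write `λ_s` for the number of blocks through `s ≤ 5` points. Summed over the blocks `b`, the
polynomial `q(x) = x (x - 2) (x - 4) (x - 6) (x - 8)` at `x = #(b ∩ S)` depends only on `#S` and the
`λ_s`. If `S` is the support of a word of `C^⊥`, every `x` is even, so that the sum is divisible by
`3840 = 2 ^ 5 * 5!`, and it vanishes when `#S < 10`. Arithmetic then shows that `C^⊥` is even and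
has minimum distance at least `10`. Hence `C` is a doubly even code containing the all-one word; it
lies in `C^⊥`, so if it were not self-dual it would have at most `2 ^ (v / 2 - 1)` words. But it has
`λ_0` words of weight `k`, and through the MacWilliams identities Delsarte's linear programming
bound shows that these are too many for so small a code. The dual solutions of the linear programs
were scaled and rounded to integers.
-/

open Finset Module

namespace SelfDualDesign

theorem card_filter_subset_powersetCard {α : Type*} [DecidableEq α] {S b : Finset α} {t : ℕ}
    (hSb : S ⊆ b) (hSt : #S ≤ t) :
    #{T ∈ b.powersetCard t | S ⊆ T} = (#b - #S).choose (t - #S) := by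
  rw [← card_sdiff_of_subset hSb, ← card_powersetCard]
  refine card_nbij' (· \ S) (· ∪ S) ?_ ?_ ?_ ?_
  · intro T hT
    simp only [mem_coe, mem_filter, mem_powersetCard] at hT
    rw [mem_coe, mem_powersetCard]
    exact ⟨sdiff_subset_sdiff hT.1.1 le_rfl, by rw [card_sdiff_of_subset hT.2, hT.1.2]⟩
  · intro U hU
    simp only [mem_coe, mem_powersetCard, subset_sdiff] at hU
    simp only [mem_coe, mem_filter, mem_powersetCard, subset_union_right, and_true,
      union_subset hU.1.1 hSb, card_union_of_disjoint hU.1.2, hU.2, true_and]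
    omega
  · intro T hT
    exact sdiff_union_of_subset (mem_filter.1 hT).2
  · intro U hU
    simp only [mem_coe, mem_powersetCard, subset_sdiff] at hU
    exact union_sdiff_cancel_right hU.1.2

/-- The number `λ_s` of blocks through any `s ≤ t` points of a `t`-`(v, k, lam)` design with
`t ≤ k`; the division is exact whenever such a design exists. -/
def blockNumber (t v k lam s : ℕ) : ℕ :=
  lam * (v - s).choose (t - s) / (k - s).choose (t - s)

section Design

variable {X : Type*} [Fintype X] [DecidableEq X] {t v k lam : ℕ} {blocks : Finset (Finset X)}

theorem IsDesign.of_le (h : IsDesign X t v k lam blocks) (htk : t ≤ k) {s : ℕ} (hst : s ≤ t) :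
    IsDesign X s v k (blockNumber t v k lam s) blocks where
  card_points := h.card_points
  card_block := h.card_block
  card_through S hS := by
    have hcount : #{T ∈ powersetCard t univ | S ⊆ T} * lam =
        #{b ∈ blocks | S ⊆ b} * (k - s).choose (t - s) := by
      refine card_mul_eq_card_mul (fun T b => T ⊆ b) (fun T hT => ?_) fun b hb => ?_
      · simp only [mem_filter, mem_powersetCard] at hT
        rw [← h.card_through T hT.1.2, bipartiteAbove, filter_filter]
        exact congrArg card <| filter_congr fun b _ => and_iff_right_of_imp hT.2.trans
      · rw [mem_filter] at hb
        rw [← h.card_block b hb.1, ← hS, ← card_filter_subset_powersetCard hb.2 (hS.trans_le hst)]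
        congr 1
        ext T
        simp only [mem_bipartiteBelow, mem_filter, mem_powersetCard, subset_univ]
        tauto
    rw [card_filter_subset_powersetCard (subset_univ S) (hS.trans_le hst), card_univ,
      h.card_points, hS, mul_comm] at hcount
    rw [blockNumber, hcount, Nat.mul_div_cancel _ (Nat.choose_pos (by omega))]

theorem IsDesign.card_blocks (h : IsDesign X 0 v k lam blocks) : #blocks = lam := by
  simpa using h.card_through ∅ card_empty

theorem IsDesign.sum_choose_card_inter (h : IsDesign X t v k lam blocks) (S : Finset X) :
    ∑ b ∈ blocks, (#(b ∩ S)).choose t = lam * (#S).choose t := by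
  have hchoose (b : Finset X) : (#(b ∩ S)).choose t = #{T ∈ S.powersetCard t | T ⊆ b} := by
    rw [← card_powersetCard]
    congr 1
    ext T
    simp only [mem_powersetCard, mem_filter, subset_inter_iff]
    tauto
  calc ∑ b ∈ blocks, (#(b ∩ S)).choose t
      = ∑ b ∈ blocks, #{T ∈ S.powersetCard t | T ⊆ b} := sum_congr rfl fun b _ => hchoose b
    _ = ∑ T ∈ S.powersetCard t, #{b ∈ blocks | T ⊆ b} := by
      simp only [card_filter]
      exact sum_comm
    _ = lam * (#S).choose t := by
      rw [sum_congr rfl fun T hT => h.card_through T (mem_powersetCard.1 hT).2, sum_const,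
        card_powersetCard, smul_eq_mul, mul_comm]

end Design

/-- The coefficients of `x (x - 2) (x - 4) (x - 6) (x - 8)` in the basis of the binomial
coefficients `x.choose s`. -/
def evenCoeff : ℕ → ℤ
  | 1 => 105
  | 2 => -210
  | 3 => 270
  | 4 => -240
  | 5 => 120
  | _ => 0

theorem sum_evenCoeff_mul_choose_two_mul (m : ℕ) :
    ∑ s ∈ range 6, evenCoeff s * (2 * m).choose s = 3840 * m.choose 5 := by
  have hchoose (n s : ℕ) :
      (s.factorial : ℤ) * n.choose s = (descPochhammer ℤ s).eval (n : ℤ) := by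
    rw [descPochhammer_eval_eq_descFactorial, Nat.descFactorial_eq_factorial_mul_choose]
    push_cast
    rfl
  have h₂ := hchoose (2 * m) 2
  have h₃ := hchoose (2 * m) 3
  have h₄ := hchoose (2 * m) 4
  have h₅ := hchoose (2 * m) 5
  have h₅' := hchoose m 5
  simp only [Nat.factorial, Nat.succ_eq_add_one, Nat.reduceAdd, zero_add, mul_one, Nat.cast_ofNat,
    Nat.cast_mul, descPochhammer_succ_right, descPochhammer_zero, CharP.cast_eq_zero, sub_zero,
    one_mul, Nat.cast_one, Polynomial.eval_mul, Polynomial.eval_X, Polynomial.eval_sub,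
    Polynomial.eval_one, Nat.reduceMul, Polynomial.eval_ofNat] at h₂ h₃ h₄ h₅ h₅'
  simp only [sum_range_succ, sum_range_zero, evenCoeff, Nat.choose_one_right, Nat.cast_mul,
    Nat.cast_ofNat]
  linear_combination -105 * h₂ + 45 * h₃ - 10 * h₄ + h₅ - 32 * h₅'

/-- The sum of `x (x - 2) (x - 4) (x - 6) (x - 8)` over the blocks `b` of a `5`-`(v, k, lam)`
design, where `x = #(b ∩ S)` for a fixed set `S` of `w` points. -/
def evenMoment (v k lam w : ℕ) : ℤ :=
  ∑ s ∈ range 6, evenCoeff s * (blockNumber 5 v k lam s * w.choose s : ℕ)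

theorem IsDesign.evenMoment_card {X : Type*} [Fintype X] [DecidableEq X] {v k lam : ℕ}
    {blocks : Finset (Finset X)} (h : IsDesign X 5 v k lam blocks) (hk : 5 ≤ k) {S : Finset X}
    (hS : ∀ b ∈ blocks, Even #(b ∩ S)) :
    evenMoment v k lam #S = 3840 * ∑ b ∈ blocks, ((#(b ∩ S) / 2).choose 5 : ℤ) := by
  calc evenMoment v k lam #S
      = ∑ s ∈ range 6, evenCoeff s * ∑ b ∈ blocks, ((#(b ∩ S)).choose s : ℤ) := by
        refine sum_congr rfl fun s hs => ?_
        rw [← (h.of_le hk (Nat.le_of_lt_succ (mem_range.1 hs))).sum_choose_card_inter,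
          Nat.cast_sum]
    _ = ∑ b ∈ blocks, ∑ s ∈ range 6, evenCoeff s * (#(b ∩ S)).choose s := by
        simp only [mul_sum]
        exact sum_comm
    _ = 3840 * ∑ b ∈ blocks, ((#(b ∩ S) / 2).choose 5 : ℤ) := by
        rw [mul_sum]
        refine sum_congr rfl fun b hb => ?_
        rw [← sum_evenCoeff_mul_choose_two_mul, Nat.two_mul_div_two_of_even (hS b hb)]

section Dual

variable {X : Type*} [Fintype X]

theorem dualCode_eq_orthogonal (C : Submodule (ZMod 2) (X → ZMod 2)) :
    dualCode C = LinearMap.BilinForm.orthogonal (dotProductBilin (ZMod 2) (ZMod 2)) C :=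
  rfl

theorem dotProductBilin_isRefl :
    LinearMap.BilinForm.IsRefl (dotProductBilin (m := X) (A := ZMod 2) (ZMod 2) (ZMod 2)) :=
  fun x y h => (dotProduct_comm y x).trans h

theorem dotProductBilin_nondegenerate :
    LinearMap.BilinForm.Nondegenerate
      (dotProductBilin (m := X) (A := ZMod 2) (ZMod 2) (ZMod 2)) :=
  ⟨fun x h => dotProduct_eq_zero x h,
    fun x h => dotProduct_eq_zero x fun y => (dotProduct_comm x y).trans (h y)⟩

theorem dualCode_dualCode (C : Submodule (ZMod 2) (X → ZMod 2)) : dualCode (dualCode C) = C := by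
  rw [dualCode_eq_orthogonal, dualCode_eq_orthogonal,
    LinearMap.BilinForm.orthogonal_orthogonal dotProductBilin_nondegenerate dotProductBilin_isRefl]

theorem natCard_le_of_lt_dualCode {C : Submodule (ZMod 2) (X → ZMod 2)} (hC : C < dualCode C) :
    Nat.card C ≤ 2 ^ ((Fintype.card X - 1) / 2) := by
  have hfinrank := Submodule.finrank_lt_finrank_of_lt hC
  rw [dualCode_eq_orthogonal,
    LinearMap.BilinForm.finrank_orthogonal dotProductBilin_nondegenerate,
    finrank_fintype_fun_eq_card] at hfinrank
  rw [natCard_eq_pow_finrank (K := ZMod 2), Nat.card_zmod]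
  exact Nat.pow_le_pow_right two_pos (by omega)

theorem span_le_dualCode_span {G : Set (X → ZMod 2)} (hG : ∀ x ∈ G, ∀ y ∈ G, x ⬝ᵥ y = 0) :
    Submodule.span (ZMod 2) G ≤ dualCode (Submodule.span (ZMod 2) G) := by
  refine Submodule.span_le.2 fun y hy x hx => ?_
  induction hx using Submodule.span_induction with
  | mem x hx => exact hG x hx y hy
  | zero => exact zero_dotProduct y
  | add x x' _ _ hx hx' => rw [add_dotProduct, hx, hx', add_zero]
  | smul a x _ hx => rw [smul_dotProduct, hx, smul_zero]

end Dual

section Support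

variable {X : Type*} [Fintype X]

/-- The support of a binary word; its cardinality is the Hamming weight. -/
def supp (c : X → ZMod 2) : Finset X := {x | c x ≠ 0}

theorem card_supp (c : X → ZMod 2) : #(supp c) = hammingNorm c := rfl

theorem supp_one : supp (1 : X → ZMod 2) = univ := by
  simp [supp]

theorem hammingNorm_one : hammingNorm (1 : X → ZMod 2) = Fintype.card X := by
  simp [hammingNorm]

theorem dotProduct_eq_zero_iff [DecidableEq X] (c d : X → ZMod 2) :
    c ⬝ᵥ d = 0 ↔ Even #(supp c ∩ supp d) := by
  have hmul : ∀ a b : ZMod 2, a * b = if a ≠ 0 ∧ b ≠ 0 then 1 else 0 := by decide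
  rw [← ZMod.natCast_eq_zero_iff_even, supp, supp, ← filter_and, natCast_card_filter]
  simp only [dotProduct, hmul]

theorem hammingNorm_add [DecidableEq X] (c d : X → ZMod 2) :
    hammingNorm (c + d) + 2 * #(supp c ∩ supp d) = hammingNorm c + hammingNorm d := by
  have hpoint : ∀ a b : ZMod 2,
      (if a + b ≠ 0 then 1 else 0) + 2 * (if a ≠ 0 ∧ b ≠ 0 then 1 else 0) =
        (if a ≠ 0 then 1 else 0) + if b ≠ 0 then 1 else 0 := by decide
  simp only [hammingNorm, supp, ← filter_and, card_filter, mul_sum, ← sum_add_distrib]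
  exact sum_congr rfl fun x _ => hpoint (c x) (d x)

theorem hammingNorm_one_add (c : X → ZMod 2) :
    hammingNorm (1 + c) + hammingNorm c = Fintype.card X := by
  classical
  have h := hammingNorm_add 1 c
  rw [supp_one, univ_inter, card_supp, hammingNorm_one] at h
  omega

theorem four_dvd_hammingNorm_of_mem_span {G : Set (X → ZMod 2)}
    (hG : ∀ x ∈ G, 4 ∣ hammingNorm x)
    (hself : Submodule.span (ZMod 2) G ≤ dualCode (Submodule.span (ZMod 2) G))
    {c : X → ZMod 2} (hc : c ∈ Submodule.span (ZMod 2) G) : 4 ∣ hammingNorm c := by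
  classical
  induction hc using Submodule.span_induction with
  | mem x hx => exact hG x hx
  | zero => simp only [hammingNorm_zero, dvd_zero]
  | add x y hx hy hx4 hy4 =>
    obtain ⟨m, hm⟩ := ((dotProduct_eq_zero_iff x y).1 (hself hy x hx)).two_dvd
    have hadd := hammingNorm_add x y
    omega
  | smul a x _ hx4 =>
    have ha : ∀ a : ZMod 2, a = 0 ∨ a = 1 := by decide
    obtain rfl | rfl := ha a
    · simp only [zero_smul, hammingNorm_zero, dvd_zero]
    · rwa [one_smul]

theorem one_mem_of_even {C : Submodule (ZMod 2) (X → ZMod 2)}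
    (hC : ∀ y ∈ dualCode C, Even (hammingNorm y)) : 1 ∈ C := by
  classical
  rw [← dualCode_dualCode C]
  intro y hy
  rw [dotProduct_eq_zero_iff, supp_one, inter_univ, card_supp]
  exact hC y hy

end Support

section MacWilliams

open Polynomial

/-- The Krawtchouk number `K_j(i)` in length `n`; the truncated subtraction is harmless for
`i ≤ n`. -/
def krawtchouk (n j i : ℕ) : ℤ :=
  ∑ s ∈ range (j + 1), (-1) ^ s * (i.choose s * (n - i).choose (j - s) : ℕ)

theorem coeff_one_sub_X_pow_mul_one_add_X_pow (n j i : ℕ) :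
    ((1 - X) ^ i * (1 + X) ^ (n - i) : ℤ[X]).coeff j = krawtchouk n j i := by
  have hcomp : (1 - X : ℤ[X]) ^ i = ((1 + X) ^ i).comp (C (-1) * X) := by
    simp [sub_eq_add_neg]
  have hcoeff (s : ℕ) : ((1 - X : ℤ[X]) ^ i).coeff s = (-1) ^ s * i.choose s := by
    rw [hcomp, comp_C_mul_X_coeff, coeff_one_add_X_pow, mul_comm]
  rw [coeff_mul, Nat.sum_antidiagonal_eq_sum_range_succ_mk]
  simp only [hcoeff, coeff_one_add_X_pow, krawtchouk, Nat.cast_mul, mul_assoc]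

/-- The nontrivial additive character `a ↦ (-1) ^ a` of the field with two elements. -/
def signChar : AddChar (ZMod 2) ℤ :=
  AddChar.zmodChar 2 (neg_one_sq : (-1 : ℤ) ^ 2 = 1)

theorem signChar_eq_one_iff : ∀ a : ZMod 2, signChar a = 1 ↔ a = 0 := by
  decide

variable {ι : Type*} [Fintype ι]

theorem sum_signChar_dotProduct_mul_X_pow [DecidableEq ι] (c : ι → ZMod 2) :
    ∑ y : ι → ZMod 2, C (signChar (c ⬝ᵥ y)) * X ^ hammingNorm y =
      (1 - X) ^ hammingNorm c * (1 + X) ^ (Fintype.card ι - hammingNorm c) := by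
  have hfactor (y : ι → ZMod 2) :
      (C (signChar (c ⬝ᵥ y)) * X ^ hammingNorm y : ℤ[X]) =
        ∏ i, C (signChar (c i * y i)) * if y i ≠ 0 then X else 1 := by
    have hsign : signChar (c ⬝ᵥ y) = ∏ i, signChar (c i * y i) :=
      map_prod signChar.toMonoidHom (fun i => Multiplicative.ofAdd (c i * y i)) univ
    rw [prod_mul_distrib, prod_ite, prod_const, prod_const_one, mul_one, hammingNorm, hsign,
      map_prod]
  have hlocal (a : ZMod 2) :
      (∑ z : ZMod 2, C (signChar (a * z)) * if z ≠ 0 then X else 1 : ℤ[X]) =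
        if a ≠ 0 then 1 - X else 1 + X := by
    have hneg : signChar 1 = -1 := by decide
    have ha : ∀ a : ZMod 2, a = 0 ∨ a = 1 := by decide
    rw [show (univ : Finset (ZMod 2)) = {0, 1} from rfl, sum_pair zero_ne_one]
    obtain rfl | rfl := ha a <;> simp [hneg, sub_eq_add_neg]
  have hcard : #{i | ¬ c i ≠ 0} = Fintype.card ι - hammingNorm c := by
    rw [filter_not, ← compl_eq_univ_sdiff, card_compl, hammingNorm]
  simp only [hfactor]
  rw [← Fintype.piFinset_univ, sum_prod_piFinset univ
    (fun i z => C (signChar (c i * z)) * if z ≠ 0 then X else 1)]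
  simp only [hlocal]
  rw [prod_ite, prod_const, prod_const, hcard, hammingNorm]

theorem sum_signChar_dotProduct_eq_krawtchouk [DecidableEq ι] (c : ι → ZMod 2) (j : ℕ) :
    ∑ y : ι → ZMod 2 with hammingNorm y = j, signChar (c ⬝ᵥ y) =
      krawtchouk (Fintype.card ι) j (hammingNorm c) := by
  rw [← coeff_one_sub_X_pow_mul_one_add_X_pow, ← sum_signChar_dotProduct_mul_X_pow,
    finsetSum_coeff, sum_filter]
  exact sum_congr rfl fun y _ => by simp only [coeff_C_mul_X_pow, eq_comm]

theorem sum_signChar_dotProduct_of_mem_dualCode (D : Submodule (ZMod 2) (ι → ZMod 2)) [Fintype D]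
    (y : ι → ZMod 2) [Decidable (y ∈ dualCode D)] :
    ∑ c : D, signChar (c.1 ⬝ᵥ y) = if y ∈ dualCode D then Fintype.card D else 0 := by
  classical
  let ψ : AddChar D ℤ := signChar.compAddMonoidHom
    (((dotProductBilin (ZMod 2) (ZMod 2)).flip y).comp D.subtype).toAddMonoidHom
  have hψ : ψ = 0 ↔ y ∈ dualCode D := by
    rw [AddChar.eq_zero_iff]
    exact ⟨fun h x hx => (signChar_eq_one_iff _).1 (h ⟨x, hx⟩),
      fun h x => (signChar_eq_one_iff _).2 (h x x.2)⟩
  have h := AddChar.sum_eq_ite ψ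
  rw [if_congr hψ rfl rfl] at h
  exact_mod_cast h

/-- The number of words of weight `i` in a binary code, the `i`-th entry of its weight
distribution. -/
noncomputable def weightCount (D : Submodule (ZMod 2) (ι → ZMod 2)) (i : ℕ) : ℕ :=
  {c | c ∈ D ∧ hammingNorm c = i}.ncard

theorem weightCount_eq_card_filter [DecidableEq ι] (D : Submodule (ZMod 2) (ι → ZMod 2))
    [DecidablePred (· ∈ D)] (i : ℕ) :
    weightCount D i = #{c : ι → ZMod 2 | c ∈ D ∧ hammingNorm c = i} := by
  rw [weightCount, ← Set.ncard_coe_finset, coe_filter_univ]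

theorem sum_weightCount_mul (D : Submodule (ZMod 2) (ι → ZMod 2)) [Fintype D] (f : ℕ → ℤ) :
    ∑ i ∈ range (Fintype.card ι + 1), weightCount D i * f i = ∑ c : D, f (hammingNorm c.1) := by
  classical
  have hmaps (c : ι → ZMod 2) (_ : c ∈ ({c | c ∈ D} : Finset (ι → ZMod 2))) :
      hammingNorm c ∈ range (Fintype.card ι + 1) :=
    mem_range.2 (Nat.lt_succ_of_le hammingNorm_le_card_fintype)
  rw [← sum_subtype {c | c ∈ D} (fun c => by simp) fun c => f (hammingNorm c),
    ← sum_fiberwise_of_maps_to hmaps]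
  refine sum_congr rfl fun i _ => ?_
  rw [sum_congr rfl fun c hc => congrArg f (mem_filter.1 hc).2, sum_const, nsmul_eq_mul,
    weightCount_eq_card_filter, filter_filter]

theorem sum_weightCount (D : Submodule (ZMod 2) (ι → ZMod 2)) :
    ∑ i ∈ range (Fintype.card ι + 1), (weightCount D i : ℤ) = Nat.card D := by
  classical
  simpa using sum_weightCount_mul D 1

theorem sum_weightCount_mul_krawtchouk (D : Submodule (ZMod 2) (ι → ZMod 2)) (j : ℕ) :
    ∑ i ∈ range (Fintype.card ι + 1), weightCount D i * krawtchouk (Fintype.card ι) j i =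
      Nat.card D * weightCount (dualCode D) j := by
  classical
  rw [sum_weightCount_mul]
  simp only [← sum_signChar_dotProduct_eq_krawtchouk]
  rw [sum_comm]
  simp only [sum_signChar_dotProduct_of_mem_dualCode]
  rw [← Nat.cast_sum, ← sum_filter, filter_filter, sum_const, weightCount_eq_card_filter,
    smul_eq_mul, Nat.card_eq_fintype_card, mul_comm, Nat.cast_mul]
  simp only [and_comm]

theorem weightCount_zero (D : Submodule (ZMod 2) (ι → ZMod 2)) : weightCount D 0 = 1 := by
  rw [weightCount, Set.ncard_eq_one]
  refine ⟨0, Set.ext fun c => ?_⟩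
  simp only [hammingNorm_eq_zero, Set.mem_ofPred_eq, Set.mem_singleton_iff,
    and_iff_right_iff_imp]
  rintro rfl
  exact D.zero_mem

theorem weightCount_eq_zero {D : Submodule (ZMod 2) (ι → ZMod 2)} {i : ℕ}
    (h : ∀ c ∈ D, hammingNorm c ≠ i) : weightCount D i = 0 := by
  have hempty : {c | c ∈ D ∧ hammingNorm c = i} = ∅ :=
    Set.eq_empty_of_forall_notMem fun c hc => h c hc.1 hc.2
  rw [weightCount, hempty, Set.ncard_empty]

theorem weightCount_card_sub {D : Submodule (ZMod 2) (ι → ZMod 2)} (hone : 1 ∈ D) {i : ℕ}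
    (hi : i ≤ Fintype.card ι) : weightCount D (Fintype.card ι - i) = weightCount D i := by
  have hequiv (c : ι → ZMod 2) : c ∈ D ∧ hammingNorm c = i ↔
      1 + c ∈ D ∧ hammingNorm (1 + c) = Fintype.card ι - i := by
    have hnorm := hammingNorm_one_add c
    rw [D.add_mem_iff_right hone]
    exact and_congr_right fun _ => by omega
  rw [weightCount, weightCount, ← Set.ncard_preimage_of_injective_subset_range
    (add_right_injective (1 : ι → ZMod 2)) fun c _ => ⟨-1 + c, add_neg_cancel_left 1 c⟩]
  exact congrArg Set.ncard (Set.ext fun c => (hequiv c).symm)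

end MacWilliams

section LinearProgramming

variable {ι : Type*} [Fintype ι]

/-- The function `i ↦ a₀ + ∑ a * K_j(i)`, where `(j, a)` runs through `L`, in length `n`. -/
def krawtchoukSum (n : ℕ) (a₀ : ℤ) (L : List (ℕ × ℤ)) (i : ℕ) : ℤ :=
  a₀ + (L.map fun p => p.2 * krawtchouk n p.1 i).sum

theorem sum_weightCount_mul_krawtchoukSum (D : Submodule (ZMod 2) (ι → ZMod 2)) (a₀ : ℤ)
    (L : List (ℕ × ℤ)) :
    ∑ i ∈ range (Fintype.card ι + 1), weightCount D i * krawtchoukSum (Fintype.card ι) a₀ L i =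
      Nat.card D * (a₀ + (L.map fun p => p.2 * (weightCount (dualCode D) p.1 : ℤ)).sum) := by
  induction L with
  | nil =>
    simp only [krawtchoukSum, List.map_nil, List.sum_nil, add_zero]
    rw [← sum_mul, sum_weightCount]
  | cons p L ih =>
    have hcons (i : ℕ) : weightCount D i * krawtchoukSum (Fintype.card ι) a₀ (p :: L) i =
        weightCount D i * krawtchoukSum (Fintype.card ι) a₀ L i +
          p.2 * (weightCount D i * krawtchouk (Fintype.card ι) p.1 i) := by
      simp only [krawtchoukSum, List.map_cons, List.sum_cons]
      ring
    simp only [hcons, sum_add_distrib, ← mul_sum, ih, sum_weightCount_mul_krawtchouk,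
      List.map_cons, List.sum_cons]
    ring

/-- An integral certificate for Delsarte's linear programming bound in length `n`. It rules out a
doubly even code that contains the all-one word and at least `b` words of weight `k`, has at most
`2 ^ ((n - 1) / 2)` words, and is contained in a dual of minimum distance at least `d`. -/
structure IsLPCertificate (n d k b : ℕ) (a₀ : ℤ) (L : List (ℕ × ℤ)) : Prop where
  nonneg : 0 ≤ a₀
  coeff : ∀ p ∈ L, 0 < p.1 ∧ (p.1 < d ∨ p.2 ≤ 0)
  dist_pos : 0 < d
  dist_le : d ≤ k
  weight_lt : 2 * k < n
  four_dvd : 4 ∣ k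
  value_nonneg : ∀ i ≤ n, 4 ∣ i → d ≤ i → i + d ≤ n → 0 ≤ krawtchoukSum n a₀ L i
  lt_value : 2 ^ ((n - 1) / 2) * a₀ < krawtchoukSum n a₀ L 0 + krawtchoukSum n a₀ L n +
    b * (krawtchoukSum n a₀ L k + krawtchoukSum n a₀ L (n - k))

variable {C : Submodule (ZMod 2) (ι → ZMod 2)} {d k b : ℕ} {a₀ : ℤ} {L : List (ℕ × ℤ)}

theorem sum_weightCount_mul_krawtchoukSum_le
    (hdist : ∀ y ∈ dualCode C, y ≠ 0 → d ≤ hammingNorm y)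
    (hL : ∀ p ∈ L, 0 < p.1 ∧ (p.1 < d ∨ p.2 ≤ 0)) :
    ∑ i ∈ range (Fintype.card ι + 1),
      weightCount C i * krawtchoukSum (Fintype.card ι) a₀ L i ≤ Nat.card C * a₀ := by
  have hterm (p) (hp : p ∈ L) : p.2 * weightCount (dualCode C) p.1 ≤ 0 := by
    obtain ⟨hpos, hlt | hle⟩ := hL p hp
    · rw [weightCount_eq_zero fun y hy hyp => ?_, Nat.cast_zero, mul_zero]
      exact hlt.not_ge (hyp ▸ hdist y hy (hammingNorm_pos_iff.1 (hyp ▸ hpos)))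
    · exact mul_nonpos_of_nonpos_of_nonneg hle (Int.natCast_nonneg _)
  have hsum : (L.map fun p => p.2 * (weightCount (dualCode C) p.1 : ℤ)).sum ≤ 0 :=
    (List.sum_le_card_nsmul _ 0 (List.forall_mem_map.2 hterm)).trans_eq (nsmul_zero _)
  rw [sum_weightCount_mul_krawtchoukSum]
  exact mul_le_mul_of_nonneg_left (by omega) (Int.natCast_nonneg _)

theorem four_dvd_and_le_of_weightCount_ne_zero (hC : C ≤ dualCode C) (hone : 1 ∈ C)
    (hfour : ∀ c ∈ C, 4 ∣ hammingNorm c) (hdist : ∀ y ∈ dualCode C, y ≠ 0 → d ≤ hammingNorm y)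
    {i : ℕ} (hi : weightCount C i ≠ 0) (hi0 : i ≠ 0) (hin : i ≠ Fintype.card ι) :
    4 ∣ i ∧ d ≤ i ∧ i + d ≤ Fintype.card ι := by
  obtain ⟨c, hc, rfl⟩ : ∃ c ∈ C, hammingNorm c = i := by
    contrapose! hi
    exact weightCount_eq_zero hi
  have hcompl := hammingNorm_one_add c
  have hne : 1 + c ≠ 0 := by
    rw [← hammingNorm_pos_iff]
    omega
  have hdcompl := hdist _ (hC (C.add_mem hone hc)) hne
  exact ⟨hfour c hc, hdist c (hC hc) (hammingNorm_ne_zero_iff.1 hi0), by omega⟩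

theorem IsLPCertificate.le_sum_weightCount (h : IsLPCertificate (Fintype.card ι) d k b a₀ L)
    (hC : C ≤ dualCode C) (hone : 1 ∈ C) (hfour : ∀ c ∈ C, 4 ∣ hammingNorm c)
    (hdist : ∀ y ∈ dualCode C, y ≠ 0 → d ≤ hammingNorm y)
    (hb : b ≤ weightCount C k) :
    krawtchoukSum (Fintype.card ι) a₀ L 0 +
        krawtchoukSum (Fintype.card ι) a₀ L (Fintype.card ι) +
        b * (krawtchoukSum (Fintype.card ι) a₀ L k +
          krawtchoukSum (Fintype.card ι) a₀ L (Fintype.card ι - k)) ≤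
      ∑ i ∈ range (Fintype.card ι + 1),
        weightCount C i * krawtchoukSum (Fintype.card ι) a₀ L i := by
  set n := Fintype.card ι
  set f := krawtchoukSum n a₀ L
  have hnonneg (i : ℕ) (hi : i ≤ n) (hi0 : i ≠ 0) (hin : i ≠ n) : 0 ≤ weightCount C i * f i := by
    obtain hzero | hne := eq_or_ne (weightCount C i) 0
    · rw [hzero, Nat.cast_zero, zero_mul]
    · obtain ⟨hi4, hdi, hdn⟩ :=
        four_dvd_and_le_of_weightCount_ne_zero hC hone hfour hdist hne hi0 hin
      exact mul_nonneg (Int.natCast_nonneg _) (h.value_nonneg i hi hi4 hdi hdn)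
  have hn4 : 4 ∣ n := by simpa only [hammingNorm_one] using hfour 1 hone
  obtain ⟨hdpos, hdk, hkn, hk4⟩ := h.dist_pos, h.dist_le, h.weight_lt, h.four_dvd
  have hfk : 0 ≤ f k := h.value_nonneg k (by omega) hk4 hdk (by omega)
  have hfnk : 0 ≤ f (n - k) := h.value_nonneg (n - k) (by omega) (by omega) (by omega) (by omega)
  have hsubset : {0, n, k, n - k} ⊆ range (n + 1) := by
    intro i
    simp only [mem_insert, mem_singleton, mem_range]
    omega
  calc f 0 + f n + b * (f k + f (n - k))
      ≤ f 0 + f n + weightCount C k * (f k + f (n - k)) := by gcongr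
    _ = ∑ i ∈ {0, n, k, n - k}, weightCount C i * f i := by
      have hWn : weightCount C n = 1 := by
        simpa only [Nat.sub_zero, weightCount_zero] using
          weightCount_card_sub hone (Nat.zero_le _)
      rw [sum_insert, sum_insert, sum_pair, weightCount_zero, hWn,
        weightCount_card_sub hone (by omega)]
      · ring
      all_goals simp only [mem_insert, mem_singleton, ne_eq]; omega
    _ ≤ ∑ i ∈ range (n + 1), weightCount C i * f i := by
      refine sum_le_sum_of_subset_of_nonneg hsubset fun i hi hi' => ?_
      simp only [mem_insert, mem_singleton, not_or] at hi'
      exact hnonneg i (Nat.le_of_lt_succ (mem_range.1 hi)) hi'.1 hi'.2.1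

theorem IsLPCertificate.isSelfDual (h : IsLPCertificate (Fintype.card ι) d k b a₀ L)
    (hC : C ≤ dualCode C) (hone : 1 ∈ C) (hfour : ∀ c ∈ C, 4 ∣ hammingNorm c)
    (hdist : ∀ y ∈ dualCode C, y ≠ 0 → d ≤ hammingNorm y) (hb : b ≤ weightCount C k) :
    IsSelfDual C := by
  by_contra hne
  have hcard : (Nat.card C : ℤ) ≤ 2 ^ ((Fintype.card ι - 1) / 2) :=
    mod_cast natCard_le_of_lt_dualCode (lt_of_le_of_ne hC hne)
  have hlower := h.le_sum_weightCount hC hone hfour hdist hb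
  have hupper := sum_weightCount_mul_krawtchoukSum_le (a₀ := a₀) hdist h.coeff
  have hmul := mul_le_mul_of_nonneg_right hcard h.nonneg
  exact absurd h.lt_value (hlower.trans (hupper.trans hmul)).not_gt

end LinearProgramming

section DesignCode

theorem incidenceMatrix_row_mem_code {X : Type*} [DecidableEq X] {blocks : Finset (Finset X)}
    (b : blocks) : (incidenceMatrix blocks).row b ∈ code blocks :=
  Submodule.subset_span ⟨b, rfl⟩

variable {X : Type*} [Fintype X] [DecidableEq X] {k : ℕ} {blocks : Finset (Finset X)}

theorem supp_incidenceMatrix_row (b : blocks) : supp ((incidenceMatrix blocks).row b) = b := by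
  ext x
  simp [supp, incidenceMatrix]

theorem hammingNorm_incidenceMatrix_row (b : blocks) :
    hammingNorm ((incidenceMatrix blocks).row b) = #b.1 := by
  rw [← card_supp, supp_incidenceMatrix_row]

theorem code_le_dualCode (hk : Even k) (hcard : ∀ b ∈ blocks, #b = k)
    (hso : IsSelfOrthogonal k blocks) : code blocks ≤ dualCode (code blocks) := by
  refine span_le_dualCode_span ?_
  rintro _ ⟨b₁, rfl⟩ _ ⟨b₂, rfl⟩
  rw [dotProduct_eq_zero_iff, supp_incidenceMatrix_row, supp_incidenceMatrix_row]
  obtain heq | hne := eq_or_ne b₁ b₂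
  · rwa [heq, inter_self, hcard b₂ b₂.2]
  · have hmod := hso b₁ b₁.2 b₂ b₂.2 (Subtype.coe_ne_coe.2 hne)
    exact Nat.even_iff.2 (Eq.trans hmod (Nat.even_iff.1 hk))

theorem four_dvd_hammingNorm_of_mem_code (hk : 4 ∣ k) (hcard : ∀ b ∈ blocks, #b = k)
    (hso : IsSelfOrthogonal k blocks) {c : X → ZMod 2} (hc : c ∈ code blocks) :
    4 ∣ hammingNorm c := by
  have hself := code_le_dualCode (even_iff_two_dvd.2 (dvd_trans (by decide) hk)) hcard hso
  refine four_dvd_hammingNorm_of_mem_span ?_ hself hc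
  rintro _ ⟨b, rfl⟩
  rwa [hammingNorm_incidenceMatrix_row, hcard b b.2]

theorem even_card_inter_supp_of_mem_dualCode {y : X → ZMod 2} (hy : y ∈ dualCode (code blocks))
    {b : Finset X} (hb : b ∈ blocks) : Even #(b ∩ supp y) := by
  have hdot := hy _ (incidenceMatrix_row_mem_code ⟨b, hb⟩)
  rwa [dotProduct_eq_zero_iff, supp_incidenceMatrix_row] at hdot

theorem card_blocks_le_weightCount (hcard : ∀ b ∈ blocks, #b = k) :
    #blocks ≤ weightCount (code blocks) k := by
  rw [← Set.ncard_coe_finset]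
  refine Set.ncard_le_ncard_of_injOn (fun b x => if x ∈ b then 1 else 0) (fun b hb => ?_) ?_
  · exact ⟨incidenceMatrix_row_mem_code ⟨b, hb⟩,
      (hammingNorm_incidenceMatrix_row ⟨b, hb⟩).trans (hcard b hb)⟩
  · intro b hb b' hb' hrow
    have hsupp : supp ((incidenceMatrix blocks).row ⟨b, hb⟩) =
      supp ((incidenceMatrix blocks).row ⟨b', hb'⟩) := congrArg supp hrow
    rwa [supp_incidenceMatrix_row, supp_incidenceMatrix_row] at hsupp

end DesignCode

/-- Numerical data proving that the code of a self-orthogonal `5`-`(v, k, lam)` design is self-dual: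
the values of `evenMoment` exclude odd weights and weights below `10` from the dual code, and the
linear programming bound does the rest. -/
structure IsCertificate (v k lam : ℕ) (a₀ : ℤ) (L : List (ℕ × ℤ)) : Prop extends
    IsLPCertificate v 10 k (blockNumber 5 v k lam 0) a₀ L where
  not_dvd_evenMoment : ∀ w ≤ v, Odd w → ¬ 3840 ∣ evenMoment v k lam w
  evenMoment_ne_zero : ∀ w < 10, 0 < w → evenMoment v k lam w ≠ 0

section Certificate

variable {X : Type*} [Fintype X] [DecidableEq X] {v k lam : ℕ} {blocks : Finset (Finset X)}
  {a₀ : ℤ} {L : List (ℕ × ℤ)}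

theorem IsCertificate.even_hammingNorm (h : IsCertificate v k lam a₀ L)
    (hdesign : IsDesign X 5 v k lam blocks) {y : X → ZMod 2} (hy : y ∈ dualCode (code blocks)) :
    Even (hammingNorm y) := by
  have hmoment := hdesign.evenMoment_card (le_trans (by decide) h.dist_le)
    fun b hb => even_card_inter_supp_of_mem_dualCode hy hb
  rw [card_supp] at hmoment
  have hle : hammingNorm y ≤ v := hdesign.card_points ▸ hammingNorm_le_card_fintype
  refine Nat.not_odd_iff_even.1 fun hodd => h.not_dvd_evenMoment _ hle hodd ?_
  exact ⟨_, hmoment⟩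

theorem IsCertificate.ten_le_hammingNorm (h : IsCertificate v k lam a₀ L)
    (hdesign : IsDesign X 5 v k lam blocks) {y : X → ZMod 2} (hy : y ∈ dualCode (code blocks))
    (hy0 : y ≠ 0) : 10 ≤ hammingNorm y := by
  by_contra! hlt
  have hmoment := hdesign.evenMoment_card (le_trans (by decide) h.dist_le)
    fun b hb => even_card_inter_supp_of_mem_dualCode hy hb
  refine h.evenMoment_ne_zero _ hlt (hammingNorm_pos_iff.2 hy0) ?_
  rw [← card_supp, hmoment, sum_eq_zero fun b _ => ?_, mul_zero]
  have hle : #(b ∩ supp y) ≤ hammingNorm y := card_le_card inter_subset_right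
  rw [Nat.choose_eq_zero_of_lt (by omega), Nat.cast_zero]

theorem IsCertificate.isSelfDual_code (h : IsCertificate v k lam a₀ L)
    (hdesign : IsDesign X 5 v k lam blocks) (hso : IsSelfOrthogonal k blocks) :
    IsSelfDual (code blocks) := by
  have hcard := hdesign.card_block
  have hk : Even k := even_iff_two_dvd.2 (dvd_trans (by decide) h.four_dvd)
  have hblocks : blockNumber 5 v k lam 0 = #blocks :=
    (hdesign.of_le (le_trans (by decide) h.dist_le) (Nat.zero_le 5)).card_blocks.symm
  have hlp := h.toIsLPCertificate
  rw [hblocks, ← hdesign.card_points] at hlp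
  exact hlp.isSelfDual (code_le_dualCode hk hcard hso)
    (one_mem_of_even fun y hy => h.even_hammingNorm hdesign hy)
    (fun c hc => four_dvd_hammingNorm_of_mem_code h.four_dvd hcard hso hc)
    (fun y hy hy0 => h.ten_le_hammingNorm hdesign hy hy0)
    (card_blocks_le_weightCount hcard)

end Certificate

theorem isCertificate_120_36 : IsCertificate 120 36 37237713920 (10 ^ 13)
    [(2, 1751132157352), (4, 183381998615), (6, 24375177093), (8, 1624624247), (28, -25),
    (30, -3), (32, -2), (34, -1)] := by
  refine ⟨⟨?_, ?_, ?_, ?_, ?_, ?_, ?_, ?_⟩, ?_, ?_⟩ <;> decide +kernel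

theorem isCertificate_120_40 : IsCertificate 120 40 1372275835848 (7 * 10 ^ 13)
    [(2, 8728469784568), (4, 615595496115), (6, 58052331268), (8, -929317344), (30, -25),
    (32, -2), (34, -2)] := by
  refine ⟨⟨?_, ?_, ?_, ?_, ?_, ?_, ?_, ?_⟩, ?_, ?_⟩ <;> decide +kernel

theorem isCertificate_120_44 : IsCertificate 120 44 26386953577600 (7 * 10 ^ 8)
    [(2, 62260291), (4, 4167072), (6, 180699), (8, 3142), (10, -57)] := by
  refine ⟨⟨?_, ?_, ?_, ?_, ?_, ?_, ?_, ?_⟩, ?_, ?_⟩ <;> decide +kernel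

theorem isCertificate_120_48 : IsCertificate 120 48 274320081834480 (2 * 10 ^ 14)
    [(2, 13221715419500), (4, 704596782897), (6, 72867199237), (8, -127971004), (24, -141),
    (30, -25), (34, -2)] := by
  refine ⟨⟨?_, ?_, ?_, ?_, ?_, ?_, ?_, ?_⟩, ?_, ?_⟩ <;> decide +kernel

theorem isCertificate_144_56 : IsCertificate 144 56 283096123959568608 (3 * 10 ^ 17)
    [(2, 12489361977391617), (4, 779720528279112), (6, -15189839661765), (8, 3881038178720),
    (36, -33), (40, -10), (44, -1)] := by
  refine ⟨⟨?_, ?_, ?_, ?_, ?_, ?_, ?_, ?_⟩, ?_, ?_⟩ <;> decide +kernel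

end SelfDualDesign

theorem proposition3p2 {X : Type*} [Fintype X] [DecidableEq X] (v k lam : ℕ)
    (hpar : (v, k, lam) ∈ ({(120, 36, 37237713920), (120, 40, 1372275835848),
      (120, 44, 26386953577600), (120, 48, 274320081834480),
      (144, 56, 283096123959568608)} : Set (ℕ × ℕ × ℕ)))
    (blocks : Finset (Finset X)) (hdesign : SelfDualDesign.IsDesign X 5 v k lam blocks)
    (hso : SelfDualDesign.IsSelfOrthogonal k blocks) :
    SelfDualDesign.IsSelfDual (SelfDualDesign.code blocks) := by
  simp only [Set.mem_insert_iff, Set.mem_singleton_iff, Prod.mk.injEq] at hpar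
  rcases hpar with ⟨rfl, rfl, rfl⟩ | ⟨rfl, rfl, rfl⟩ | ⟨rfl, rfl, rfl⟩ | ⟨rfl, rfl, rfl⟩ |
    ⟨rfl, rfl, rfl⟩
  · exact SelfDualDesign.isCertificate_120_36.isSelfDual_code hdesign hso
  · exact SelfDualDesign.isCertificate_120_40.isSelfDual_code hdesign hso
  · exact SelfDualDesign.isCertificate_120_44.isSelfDual_code hdesign hso
  · exact SelfDualDesign.isCertificate_120_48.isSelfDual_code hdesign hso
  · exact SelfDualDesign.isCertificate_144_56.isSelfDual_code hdesign hso
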